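/- For $k\ge 1$ and positive integers $d_1,\dots,d_k$, let $\mathbb{R}^{d_1\times\dots\times d_k}$ be the space of real $k$-way arrays (real tensors of order $k$). The outer product of $x_1\in\mathbb{R}^{d_1},\dots,x_k\in\mathbb{R}^{d_k}$ is the tensor $x_1\otimes\dots\otimes x_k$ with entries $(x_1)_{j_1}\cdots(x_k)_{j_k}$. The rank $\operatorname{rank}_\otimes(A)$ of a tensor $A$ is the least $m\ge 0$ such that $A$ is a sum of $m$ outer products of vectors. Given a norm $\lVert\cdot\rVert$ on $\mathbb{R}^{d_1\times\dots\times d_k}$, a best rank-$r$ approximation of $A$ is a tensor $B$ with $\operatorname{rank}_\otimes(B)\le r$ such that $\lVert A-B\rVert\le\lVert A-C\rVert$ for all tensors $C$ of the same format with $\operatorname{rank}_\otimes(C)\le r$. Let $s\ge 1$ and $r\ge 2s$ be integers. (1) There are $d_1,d_2,d_3$, a sequence $(B_n)$ in $\mathbb{R}^{d_1\times d_2\times d_3}$ and a tensor $B\in\mathbb{R}^{d_1\times d_2\times d_3}$ such that $\operatorname{rank}_\otimes(B_n)\le r$ for all $n$, $\lim_{n\to\infty}B_n=B$, and $\operatorname{rank}_\otimes(B)=r+s$.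 (2) For every $k\ge 3$ there are $d_1,\dots,d_k$ and a tensor $A\in\mathbb{R}^{d_1\times\dots\times d_k}$ such that $\operatorname{rank}_\otimes(A)=r+s$ and, for every norm on $\mathbb{R}^{d_1\times\dots\times d_k}$, $A$ has no best rank-$r$ approximation with respect to that norm. -/

import Mathlib

open scoped Topology

/-- Real hypermatrices of format `d 0 × ⋯ × d (k - 1)`, that is, real tensors of order `k`.
The topology is the product topology, which is the one induced by any norm. -/
abbrev RealTensor {k : ℕ} (d : Fin k → ℕ) : Type :=
  ((i : Fin k) → Fin (d i)) → ℝ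

namespace RealTensor

variable {k : ℕ} {d : Fin k → ℕ}

/-- The outer product `x 0 ⊗ ⋯ ⊗ x (k - 1)`, with entries
`x 0 (j 0) * ⋯ * x (k - 1) (j (k - 1))`. -/
def outer (x : (i : Fin k) → Fin (d i) → ℝ) : RealTensor d :=
  fun j => ∏ i, x i (j i)

/-- `A` is a sum of `m` decomposable tensors. -/
def IsSumOfDecomposables (A : RealTensor d) (m : ℕ) : Prop :=
  ∃ x : Fin m → (i : Fin k) → Fin (d i) → ℝ, A = ∑ l, outer (x l)

/-- The outer-product rank: the least number of decomposable tensors with sum `A`. -/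
noncomputable def rank (A : RealTensor d) : ℕ :=
  sInf {m : ℕ | A.IsSumOfDecomposables m}

/-- Every tensor of positive order is a finite sum of decomposable tensors, so that the minimum
in the definition of the rank is over a non-empty set. -/
theorem exists_isSumOfDecomposables (hk : 0 < k) (A : RealTensor d) :
    ∃ m : ℕ, A.IsSumOfDecomposables m := by
  classical
  let e := Fintype.equivFin ((i : Fin k) → Fin (d i))
  let i₀ : Fin k := ⟨0, hk⟩
  refine ⟨_, fun l i t =>
    (if i = i₀ then A (e.symm l) else 1) * (if t = e.symm l i then 1 else 0), ?_⟩
  funext j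
  rw [Finset.sum_apply, ← Equiv.sum_comp e, Finset.sum_eq_single j]
  · simp [outer]
  · intro b _ hb
    obtain ⟨i, hi⟩ := Function.ne_iff.mp hb
    exact Finset.prod_eq_zero (Finset.mem_univ i) (by simp [Ne.symm hi])
  · simp

/-- `B` is a best rank-`r` approximation of `A` with respect to `N`: it minimizes `N (A - C)`
over all tensors `C` of rank at most `r`. -/
def IsBestRankApprox (N : Seminorm ℝ (RealTensor d)) (r : ℕ) (A B : RealTensor d) : Prop :=
  B.rank ≤ r ∧ ∀ C : RealTensor d, C.rank ≤ r → N (A - B) ≤ N (A - C)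

end RealTensor

open Matrix

namespace RealTensor

section Decomposable

variable {k : ℕ} {d : Fin k → ℕ}

/-! The tensor `e ⊗ e ⊗ f + e ⊗ f ⊗ e + f ⊗ e ⊗ e` is the derivative at `ε = 0` of the cube of `e +
ε f`, hence a limit of difference quotients of rank at most 2, yet it has rank 3. The direct sum of
`s` copies and `t = r - 2 * s` cubes is thus a limit of tensors of rank at most `2 * s + t = r` and
has rank `3 * s + t = r + s`. The lower bound (`le_card_of_tangentForm_eq_sum`) is by substitution:
a choice of the `f`-coordinates of `x` kills `s` terms and leaves a nondegenerate bilinear form in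
`2 * s + t` variables. Contraction carries the bound to higher orders. -/

theorem isSumOfDecomposables_outer (x : (i : Fin k) → Fin (d i) → ℝ) :
    (outer x).IsSumOfDecomposables 1 :=
  ⟨fun _ => x, by simp⟩

theorem IsSumOfDecomposables.add {A B : RealTensor d} {m n : ℕ}
    (hA : A.IsSumOfDecomposables m) (hB : B.IsSumOfDecomposables n) :
    (A + B).IsSumOfDecomposables (m + n) := by
  obtain ⟨x, rfl⟩ := hA
  obtain ⟨y, rfl⟩ := hB
  exact ⟨Fin.append x y, by simp [Fin.sum_univ_add]⟩

theorem IsSumOfDecomposables.sum {n m : ℕ} {A : Fin n → RealTensor d}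
    (hA : ∀ i, (A i).IsSumOfDecomposables m) : (∑ i, A i).IsSumOfDecomposables (n * m) := by
  induction n with
  | zero => exact ⟨fun l => (Fin.cast (zero_mul m) l).elim0, by
      have : IsEmpty (Fin (0 * m)) := by rw [zero_mul]; infer_instance
      simp⟩
  | succ n ih =>
    rw [Fin.sum_univ_castSucc, Nat.succ_mul]
    exact (ih fun i => hA i.castSucc).add (hA _)

theorem rank_le_of_isSumOfDecomposables {A : RealTensor d} {m : ℕ}
    (hA : A.IsSumOfDecomposables m) : A.rank ≤ m :=
  Nat.sInf_le hA

theorem isSumOfDecomposables_rank (hk : 0 < k) (A : RealTensor d) :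
    A.IsSumOfDecomposables A.rank :=
  Nat.sInf_mem (exists_isSumOfDecomposables hk A)

/-- A tensor that is a limit of tensors of rank at most `r` but has larger rank has no best
rank-`r` approximation. -/
theorem not_exists_isBestRankApprox_of_tendsto {r : ℕ} {A : RealTensor d} {B : ℕ → RealTensor d}
    (hB : ∀ n, (B n).rank ≤ r) (hlim : Filter.Tendsto B Filter.atTop (𝓝 A)) (hA : r < A.rank)
    (N : Seminorm ℝ (RealTensor d)) (hN : ∀ C : RealTensor d, N C = 0 → C = 0) :
    ¬ ∃ C : RealTensor d, IsBestRankApprox N r A C := by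
  rintro ⟨C, hC, hmin⟩
  -- A finite convex function on a finite-dimensional space is continuous.
  have hcont : Continuous N := continuousOn_univ.1 (N.convexOn.continuousOn isOpen_univ)
  have h0 : Filter.Tendsto (fun n => N (A - B n)) Filter.atTop (𝓝 0) := by
    have := (hcont.tendsto _).comp (tendsto_const_nhds (x := A) |>.sub hlim)
    simpa [Function.comp_def] using this
  have hle : N (A - C) ≤ 0 := ge_of_tendsto' h0 fun n => hmin _ (hB n)
  have := hN _ (le_antisymm hle (apply_nonneg N _))
  rw [sub_eq_zero] at this
  rw [← this] at hC
  omega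

end Decomposable

/-- The trilinear form of the direct sum of `s` copies of the tensor
`e ⊗ e ⊗ f + e ⊗ f ⊗ e + f ⊗ e ⊗ e` and `t` copies of `e ⊗ e ⊗ e`. -/
def tangentForm {s t : ℕ} (x y z : Fin s ⊕ Fin s ⊕ Fin t → ℝ) : ℝ :=
  ∑ i, (x (.inl i) * y (.inl i) * z (.inr (.inl i)) +
      x (.inl i) * y (.inr (.inl i)) * z (.inl i) +
      x (.inr (.inl i)) * y (.inl i) * z (.inl i)) +
    ∑ i, x (.inr (.inr i)) * y (.inr (.inr i)) * z (.inr (.inr i))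

/-- For fixed `x`, each tangent block is the matrix `[[c, 1], [1, 0]]`, invertible whatever the
`f`-coordinate `c` of `x` is. This leaves `c` free for the substitution. -/
theorem tangentForm_nondegenerate {s t : ℕ} {x y : Fin s ⊕ Fin s ⊕ Fin t → ℝ}
    (hx : ∀ i, x (.inl i) = 1) (hx' : ∀ i, x (.inr (.inr i)) = 1)
    (h : ∀ z, tangentForm x y z = 0) : y = 0 := by
  have h1 (i) : y (.inl i) = 0 := by
    simpa [tangentForm, Pi.single_apply, hx] using h (Pi.single (.inr (.inl i)) 1)
  funext j
  rcases j with i | i | i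
  · exact h1 i
  · simpa [tangentForm, Pi.single_apply, hx, h1] using h (Pi.single (.inl i) 1)
  · simpa [tangentForm, Pi.single_apply, hx'] using h (Pi.single (.inr (.inr i)) 1)

/-- If no nonzero vector is orthogonal to all rows of `F`, then some subfamily of `n` rows
takes arbitrary prescribed values on a suitable vector. -/
theorem exists_rows_mulVec_surjective {m n : ℕ} (F : Matrix (Fin m) (Fin n) ℝ)
    (hF : ∀ b, F *ᵥ b = 0 → b = 0) :
    ∃ S : Finset (Fin m), S.card = n ∧ ∀ g : Fin m → ℝ, ∃ b, ∀ l ∈ S, (F *ᵥ b) l = g l := by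
  classical
  obtain ⟨κ, a, ha, hspan, hli⟩ := exists_linearIndependent' ℝ F.row
  have : Finite κ := Finite.of_injective a ha
  have := Fintype.ofFinite κ
  have hrank : F.rank = n := by
    have hinj : Function.Injective F.mulVecLin :=
      (injective_iff_map_eq_zero _).2 fun b hb => hF b (by simpa using hb)
    rw [Matrix.rank, LinearMap.finrank_range_of_inj hinj]
    simp
  have hcard : Fintype.card κ = n := by
    rw [← finrank_span_eq_card hli, hspan, ← F.rank_eq_finrank_span_row, hrank]
  refine ⟨Finset.univ.image a, by rw [Finset.card_image_of_injective _ ha]; simpa, fun g => ?_⟩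
  have hG : (F.submatrix a id).rank = Fintype.card κ := LinearIndependent.rank_matrix hli
  have hsurj : Function.Surjective (F.submatrix a id).mulVecLin := by
    rw [← LinearMap.range_eq_top]
    apply Submodule.eq_top_of_finrank_eq
    rw [← Matrix.rank, hG]
    simp
  obtain ⟨b, hb⟩ := hsurj (g ∘ a)
  refine ⟨b, fun l hl => ?_⟩
  obtain ⟨q, -, rfl⟩ := Finset.mem_image.1 hl
  exact congrFun hb q

theorem le_card_of_tangentForm_eq_sum {s t m : ℕ} (u v w : Fin m → Fin s ⊕ Fin s ⊕ Fin t → ℝ)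
    (h : ∀ x y z, tangentForm x y z = ∑ l, (u l ⬝ᵥ x) * (v l ⬝ᵥ y) * (w l ⬝ᵥ z)) :
    3 * s + t ≤ m := by
  classical
  let F : Matrix (Fin m) (Fin s) ℝ := Matrix.of fun l i => u l (.inr (.inl i))
  have hext (l : Fin m) (p : Fin s → ℝ) (b : Fin s → ℝ) (q : Fin t → ℝ) :
      u l ⬝ᵥ Sum.elim p (Sum.elim b q) = u l ⬝ᵥ Sum.elim p (Sum.elim 0 q) + (F *ᵥ b) l := by
    simp [dotProduct, Matrix.mulVec, F]
    ring
  obtain ⟨S, hS, hsurj⟩ := exists_rows_mulVec_surjective F fun b hb => by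
    have h0 (y z) : tangentForm (Sum.elim 0 (Sum.elim b (0 : Fin t → ℝ))) y z = 0 := by
      rw [h]
      refine Finset.sum_eq_zero fun l _ => ?_
      rw [hext, hb]
      simp [dotProduct]
    funext i
    simpa [tangentForm, Pi.single_apply] using h0 (Pi.single (.inl i) 1) (Pi.single (.inl i) 1)
  -- This `b` makes the forms `u l`, `l ∈ S`, vanish at `x = (1, b, 1)`.
  obtain ⟨b, hb⟩ := hsurj fun l => -(u l ⬝ᵥ Sum.elim 1 (Sum.elim 0 1))
  let V : Matrix {l // l ∉ S} (Fin s ⊕ Fin s ⊕ Fin t) ℝ := Matrix.of fun l => v l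
  -- A vector `y` killed by the other `v l` lies in the kernel of the form at this `x`, so at least
  -- `2 * s + t` terms lie outside `S`.
  have hinj : Function.Injective V.mulVecLin := by
    refine (injective_iff_map_eq_zero _).2 fun y hy => ?_
    refine tangentForm_nondegenerate (x := Sum.elim 1 (Sum.elim b 1))
      (by simp) (by simp) fun z => ?_
    rw [h]
    refine Finset.sum_eq_zero fun l _ => ?_
    by_cases hl : l ∈ S
    · rw [hext, hb l hl]
      simp
    · have : v l ⬝ᵥ y = 0 := congrFun hy ⟨l, hl⟩
      simp [this]
  have hle := LinearMap.finrank_le_finrank_of_injective hinj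
  have hSm : S.card ≤ m := by simpa using S.card_le_univ
  simp [Fintype.card_subtype_compl] at hle
  omega

section Padding

variable {k r : ℕ} [NeZero r]

/-- The outer product of three vectors, padded to order `k + 3` by copies of the first
standard basis vector. -/
def paddedOuter (k : ℕ) (u v w : Fin r → ℝ) : RealTensor (fun _ : Fin (k + 3) => r) :=
  outer (d := fun _ : Fin (k + 3) => r)
    (vecCons u (vecCons v (vecCons w fun _ => Pi.single 0 1)))

theorem paddedOuter_apply (u v w : Fin r → ℝ) (j : Fin (k + 3) → Fin r) :
    paddedOuter k u v w j = u (j 0) * v (j 1) * w (j 2) *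
      ∏ i : Fin k, (Pi.single 0 1 : Fin r → ℝ) (j i.succ.succ.succ) := by
  simp only [paddedOuter, outer, Fin.prod_univ_succ, cons_val_zero, cons_val_succ, mul_assoc]
  rfl

theorem isSumOfDecomposables_paddedOuter (u v w : Fin r → ℝ) :
    (paddedOuter k u v w).IsSumOfDecomposables 1 :=
  isSumOfDecomposables_outer _

/-- The contraction of the first three modes of a tensor with `x`, `y` and `z`, and of the
remaining modes with the first standard basis vector. -/
def contract (x y z : Fin r → ℝ) : RealTensor (fun _ : Fin (k + 3) => r) →ₗ[ℝ] ℝ where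
  toFun A := ∑ a, ∑ b, ∑ c, x a * y b * z c * A (vecCons a (vecCons b (vecCons c fun _ => 0)))
  map_add' A B := by simp [mul_add, Finset.sum_add_distrib]
  map_smul' c A := by simp [Finset.mul_sum, mul_left_comm]

/-- The scalar from the padding modes is absorbed into the third factor, so contraction does not
increase the number of terms. -/
theorem contract_outer (x y z : Fin r → ℝ) (ξ : Fin (k + 3) → Fin r → ℝ) :
    contract x y z (outer (d := fun _ : Fin (k + 3) => r) ξ) =
      (ξ 0 ⬝ᵥ x) * (ξ 1 ⬝ᵥ y) * (((∏ i : Fin k, ξ i.succ.succ.succ 0) • ξ 2) ⬝ᵥ z) := by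
  have h (a b : Fin r) : ∑ c, x a * y b * z c *
      outer (d := fun _ : Fin (k + 3) => r) ξ (vecCons a (vecCons b (vecCons c fun _ => 0))) =
      (ξ 0 a * x a) * ((ξ 1 b * y b) *
        (((∏ i : Fin k, ξ i.succ.succ.succ 0) • ξ 2) ⬝ᵥ z)) := by
    simp only [outer, Fin.prod_univ_succ, cons_val_zero, cons_val_succ, dotProduct,
      Finset.mul_sum, Pi.smul_apply, smul_eq_mul, Fin.succ_zero_eq_one, Fin.succ_one_eq_two]
    exact Finset.sum_congr rfl fun c _ => by ring
  simp only [contract, LinearMap.coe_mk, AddHom.coe_mk, h, ← Finset.mul_sum, ← Finset.sum_mul]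
  simp only [dotProduct, mul_assoc]

theorem contract_paddedOuter (x y z u v w : Fin r → ℝ) :
    contract x y z (paddedOuter k u v w) = (u ⬝ᵥ x) * (v ⬝ᵥ y) * (w ⬝ᵥ z) := by
  rw [paddedOuter, contract_outer]
  simp

variable {s t : ℕ}

/-- The direct sum of `s` copies of `e ⊗ e ⊗ f + e ⊗ f ⊗ e + f ⊗ e ⊗ e` and `t` copies of
`e ⊗ e ⊗ e`, padded to order `k + 3`. -/
def tangentTensor (k : ℕ) (E : Fin s ⊕ Fin s ⊕ Fin t ≃ Fin r) :
    RealTensor (fun _ : Fin (k + 3) => r) :=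
  let e : Fin s ⊕ Fin s ⊕ Fin t → Fin r → ℝ := fun i => Pi.single (E i) 1
  ∑ i, (paddedOuter k (e (.inl i)) (e (.inl i)) (e (.inr (.inl i))) +
      paddedOuter k (e (.inl i)) (e (.inr (.inl i))) (e (.inl i)) +
      paddedOuter k (e (.inr (.inl i))) (e (.inl i)) (e (.inl i))) +
    ∑ i, paddedOuter k (e (.inr (.inr i))) (e (.inr (.inr i))) (e (.inr (.inr i)))

theorem contract_tangentTensor (E : Fin s ⊕ Fin s ⊕ Fin t ≃ Fin r) (x y z : Fin r → ℝ) :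
    contract x y z (tangentTensor k E) = tangentForm (x ∘ E) (y ∘ E) (z ∘ E) := by
  simp [tangentTensor, tangentForm, contract_paddedOuter]

theorem rank_tangentTensor (E : Fin s ⊕ Fin s ⊕ Fin t ≃ Fin r) :
    (tangentTensor k E).rank = 3 * s + t := by
  refine le_antisymm (rank_le_of_isSumOfDecomposables ?_) ?_
  · rw [show 3 * s + t = s * 3 + t * 1 by ring]
    have h := isSumOfDecomposables_paddedOuter (k := k) (r := r)
    exact (IsSumOfDecomposables.sum fun _ => ((h _ _ _).add (h _ _ _)).add (h _ _ _)).add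
      (IsSumOfDecomposables.sum fun _ => h _ _ _)
  · obtain ⟨ξ, hξ⟩ := isSumOfDecomposables_rank (Nat.succ_pos _) (tangentTensor k E)
    refine le_card_of_tangentForm_eq_sum (fun l => ξ l 0 ∘ E) (fun l => ξ l 1 ∘ E)
      (fun l => ((∏ i : Fin k, ξ l i.succ.succ.succ 0) • ξ l 2) ∘ E) fun x y z => ?_
    have h := contract_tangentTensor (k := k) E (x ∘ E.symm) (y ∘ E.symm) (z ∘ E.symm)
    rw [hξ, map_sum] at h
    simp only [Function.comp_assoc, Equiv.symm_comp_self, Function.comp_id] at h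
    rw [← h]
    refine Finset.sum_congr rfl fun l _ => ?_
    rw [contract_outer]
    simp only [dotProduct_comp_equiv_symm]

/-- The difference quotients approximating `tangentTensor`. -/
noncomputable def secantTensor (k : ℕ) (E : Fin s ⊕ Fin s ⊕ Fin t ≃ Fin r) (ε : ℝ) :
    RealTensor (fun _ : Fin (k + 3) => r) :=
  let e : Fin s ⊕ Fin s ⊕ Fin t → Fin r → ℝ := fun i => Pi.single (E i) 1
  ∑ i, (paddedOuter k (ε⁻¹ • (e (.inl i) + ε • e (.inr (.inl i))))
        (e (.inl i) + ε • e (.inr (.inl i))) (e (.inl i) + ε • e (.inr (.inl i))) +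
      paddedOuter k (-ε⁻¹ • e (.inl i)) (e (.inl i)) (e (.inl i))) +
    ∑ i, paddedOuter k (e (.inr (.inr i))) (e (.inr (.inr i))) (e (.inr (.inr i)))

theorem rank_secantTensor_le (E : Fin s ⊕ Fin s ⊕ Fin t ≃ Fin r) (ε : ℝ) :
    (secantTensor k E ε).rank ≤ 2 * s + t := by
  refine rank_le_of_isSumOfDecomposables ?_
  rw [show 2 * s + t = s * 2 + t * 1 by ring]
  have h := isSumOfDecomposables_paddedOuter (k := k) (r := r)
  exact (IsSumOfDecomposables.sum fun _ => (h _ _ _).add (h _ _ _)).add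
    (IsSumOfDecomposables.sum fun _ => h _ _ _)

theorem secant_block_eq (e f : Fin r → ℝ) {ε : ℝ} (hε : ε ≠ 0) :
    paddedOuter k (ε⁻¹ • (e + ε • f)) (e + ε • f) (e + ε • f) + paddedOuter k (-ε⁻¹ • e) e e =
      paddedOuter k e e f + paddedOuter k e f e + paddedOuter k f e e +
        (ε • (paddedOuter k e f f + paddedOuter k f e f + paddedOuter k f f e) +
          ε ^ 2 • paddedOuter k f f f) := by
  funext j
  simp only [Pi.add_apply, Pi.smul_apply, smul_eq_mul, paddedOuter_apply]
  field_simp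
  ring

theorem tendsto_secantTensor (E : Fin s ⊕ Fin s ⊕ Fin t ≃ Fin r) :
    Filter.Tendsto (fun n : ℕ => secantTensor k E (1 / ((n : ℝ) + 1))) Filter.atTop
      (𝓝 (tangentTensor k E)) := by
  refine Filter.Tendsto.add (tendsto_finsetSum _ fun i _ => ?_) tendsto_const_nhds
  have hε : Filter.Tendsto (fun n : ℕ => 1 / ((n : ℝ) + 1)) Filter.atTop (𝓝 0) :=
    tendsto_one_div_add_atTop_nhds_zero_nat
  have hne (n : ℕ) : 1 / ((n : ℝ) + 1) ≠ 0 := by positivity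
  simp only [secant_block_eq _ _ (hne _)]
  have key (A B C : RealTensor (fun _ : Fin (k + 3) => r)) :
      Filter.Tendsto (fun n : ℕ => A + ((1 / ((n : ℝ) + 1)) • B + (1 / ((n : ℝ) + 1)) ^ 2 • C))
        Filter.atTop (𝓝 A) := by
    simpa using tendsto_const_nhds (x := A) |>.add ((hε.smul_const B).add ((hε.pow 2).smul_const C))
  exact key _ _ _

end Padding

/-- For every `s ≥ 1`, `r ≥ 2 * s` and every order at least three there is a tensor of rank
`r + s` that is a limit of tensors of rank at most `r`. -/
theorem exists_tendsto_rank_jump (k : ℕ) {s r : ℕ} (hs : 1 ≤ s) (hr : 2 * s ≤ r) :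
    ∃ (d : Fin (k + 3) → ℕ) (B : ℕ → RealTensor d) (A : RealTensor d),
      (∀ n, (B n).rank ≤ r) ∧ Filter.Tendsto B Filter.atTop (𝓝 A) ∧ A.rank = r + s := by
  have : NeZero r := ⟨by omega⟩
  -- Two coordinates per tangent block and one per cube fill dimension `r` exactly.
  let E : Fin s ⊕ Fin s ⊕ Fin (r - 2 * s) ≃ Fin r := Fintype.equivFinOfCardEq (by simp; omega)
  refine ⟨_, _, tangentTensor k E, fun n => ?_, tendsto_secantTensor E, ?_⟩
  · exact (rank_secantTensor_le E _).trans (by omega)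
  · rw [rank_tangentTensor]
    omega

end RealTensor

theorem proposition4p11 (s r : ℕ) (hs : 1 ≤ s) (hr : 2 * s ≤ r) :
    (∃ (d : Fin 3 → ℕ) (B : ℕ → RealTensor d) (B' : RealTensor d),
      (∀ n, (B n).rank ≤ r) ∧
      Filter.Tendsto B Filter.atTop (𝓝 B') ∧
      B'.rank = r + s) ∧
    (∀ k : ℕ, 3 ≤ k →
      ∃ (d : Fin k → ℕ) (A : RealTensor d),
        A.rank = r + s ∧
        -- `N` ranges over all norms, that is, over the seminorms that vanish only at zero
        ∀ N : Seminorm ℝ (RealTensor d), (∀ C : RealTensor d, N C = 0 → C = 0) →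
          ¬ ∃ B : RealTensor d, RealTensor.IsBestRankApprox N r A B) := by
  refine ⟨RealTensor.exists_tendsto_rank_jump 0 hs hr, fun k hk => ?_⟩
  obtain ⟨k, rfl⟩ := Nat.exists_eq_add_of_le' hk
  obtain ⟨d, B, A, hB, hlim, hA⟩ := RealTensor.exists_tendsto_rank_jump k hs hr
  exact ⟨d, A, hA, RealTensor.not_exists_isBestRankApprox_of_tendsto hB hlim (by omega)⟩
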